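/- A \emph{pattern} of length $k\ge 1$ is a permutation $\pi=\pi(1)\cdots\pi(k)$ of $\{1,\dots,k\}$. A \emph{rooted forest} on $[n]=\{1,\dots,n\}$ is an acyclic graph with vertex set $[n]$ in which every connected component has one distinguished vertex, its root; a \emph{rooted tree} on $[n]$ is a connected (hence nonempty) rooted forest on $[n]$. A vertex $u$ is an \emph{ancestor} of a vertex $v$ if $u$ lies on the path from the root of the component of $v$ to $v$. A rooted forest on $[n]$ \emph{contains} $\pi$ if there are vertices $v_1,\dots,v_k\in[n]$ such that $v_i$ is an ancestor of $v_{i+1}$ for $1\le i<k$ and the sequence $v_1,\dots,v_k$ is in the same relative order as $\pi(1),\dots,\pi(k)$. It \emph{avoids} a set $S$ of patterns if it contains no $\pi\in S$. Let $f_n(S)$ and $t_n(S)$ denote the numbers of rooted forests and of rooted trees on $[n]$, respectively, that avoid $S$. Let $S$ be any (possibly empty or infinite) set of patterns such that no $\pi\in S$ begins with $1$, or such that no $\pi\in S$ begins with its largest element. Then the limits \[\lim_{n\to\infty}\frac{f_n(S)^{1/n}}{n}\qquad\text{and}\qquad\lim_{n\to\infty}\frac{t_n(S)^{1/n}}{n}\]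 both exist (as finite real numbers) and are equal. -/

import Mathlib

open Filter Topology

/-- A rooted forest whose vertices are labeled by (and identified with) the elements of `V`:
an acyclic simple graph together with exactly one distinguished root in every component. -/
@[ext]
structure RootedForest (V : Type*) where
  graph : SimpleGraph V
  acyclic : graph.IsAcyclic
  roots : Set V
  existsUnique_root : ∀ v : V, ∃! r : V, r ∈ roots ∧ graph.Reachable r v

namespace RootedForest

/-- There are only finitely many rooted forests on a finite set, so that counting them by
`Nat.card` is meaningful. -/
instance instFinite (V : Type*) [Finite V] : Finite (RootedForest V) :=
  Finite.of_injective (fun F : RootedForest V => (F.graph, F.roots)) fun _ _ h =>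
    RootedForest.ext (congrArg Prod.fst h) (congrArg Prod.snd h)

/-- `u` is an ancestor of `v`: it lies on the path from a root to `v`
(in particular every vertex is an ancestor of itself). -/
def IsAncestor {V : Type*} (F : RootedForest V) (u v : V) : Prop :=
  ∃ r ∈ F.roots, ∃ p : F.graph.Walk r v, p.IsPath ∧ u ∈ p.support

/-- A rooted tree is a connected (in particular nonempty) rooted forest. -/
def IsTree {V : Type*} (F : RootedForest V) : Prop :=
  F.graph.Connected

end RootedForest

/-- A pattern: a permutation of a nonempty initial segment. The pattern `⟨k, π⟩` has length
`k + 1`, and the values `1, …, k + 1` are represented by the elements of `Fin (k + 1)`. -/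
abbrev Pattern : Type := Σ k : ℕ, Equiv.Perm (Fin (k + 1))

namespace Pattern

/-- The first entry of the pattern is its smallest element. -/
def BeginsWithSmallest (π : Pattern) : Prop := π.2 0 = 0

/-- The first entry of the pattern is its largest element. -/
def BeginsWithLargest (π : Pattern) : Prop := π.2 0 = Fin.last π.1

end Pattern

namespace RootedForest

/-- An instance of `π` in `F`: a sequence of vertices, each an ancestor of the next, whose labels
are in the same relative order as `π`. -/
def IsInstance {V : Type*} [LinearOrder V] (F : RootedForest V) (π : Pattern)
    (v : Fin (π.1 + 1) → V) : Prop :=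
  (∀ i : Fin π.1, F.IsAncestor (v i.castSucc) (v i.succ)) ∧
    ∀ i j : Fin (π.1 + 1), v i < v j ↔ π.2 i < π.2 j

/-- `F` (classically) avoids every pattern of `S`. -/
def Avoids {V : Type*} [LinearOrder V] (F : RootedForest V) (S : Set Pattern) : Prop :=
  ∀ π ∈ S, ¬ ∃ v : Fin (π.1 + 1) → V, F.IsInstance π v

end RootedForest

/-- The number `f_n(S)` of rooted forests on `n` labels that avoid `S`. -/
noncomputable def numForests (S : Set Pattern) (n : ℕ) : ℕ :=
  Nat.card {F : RootedForest (Fin n) // F.Avoids S}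

/-- The number `t_n(S)` of rooted trees on `n` labels that avoid `S`. -/
noncomputable def numTrees (S : Set Pattern) (n : ℕ) : ℕ :=
  Nat.card {F : RootedForest (Fin n) // F.IsTree ∧ F.Avoids S}

/-! Complementing labels exchanges patterns beginning with their smallest and with their largest
entry, and preserves both counts, so one may assume that no pattern of `S` begins with its smallest
entry.

Take two avoiding forests on disjoint label sets and join a new root, carrying the smallest label,
to the second one. The first vertex of any pattern instance is an ancestor of the others, so the
instance lies in the first forest, or in the second, or starts at the new root. The first two are
excluded by avoidance, and the last would make the pattern begin with its smallest entry. The label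
split can be read off from the descendants of the new root, so `choose_mul_numForests_le` gives
`(m+n choose m) f_m f_n ≤ f_{m+n+1}`.

Hence `c_n = log (f_{n-1} / (n-1)!)` is superadditive up to an error `log (p + q)`. Such an error is
harmless in Fekete's lemma, because splitting into nearly equal halves makes the accumulated loss
linear with a small constant (`le_apply_mul_of_almost_superadditive`). A parent function determines
a forest, so `f_n ≤ (n+1)^n`, which bounds `c_n / n`. Thus `c_n / n` has a finite limit `L`, and
Stirling's formula turns it into the limit `exp (L - 1)` for forests. Trees follow from `f_{n-1} ≤
t_n ≤ f_n`, the first inequality again by adding a smallest root.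

Grafting and relabelling are carried out on ancestor relations, which encode rooted forests
bijectively. -/

/-! ### Forest orders and their cover graphs -/

/-- The ancestor relations of rooted forests: partial orders in which the elements below any
given element form a chain. -/
structure IsForestOrder {V : Type*} (R : V → V → Prop) : Prop where
  refl : ∀ v, R v v
  trans : ∀ {u v w}, R u v → R v w → R u w
  antisymm : ∀ {u v}, R u v → R v u → u = v
  chain : ∀ {u v w}, R u w → R v w → R u v ∨ R v u

/-- `u` is immediately below `v` in the relation `R`. -/
def RelCovers {V : Type*} (R : V → V → Prop) (u v : V) : Prop :=
  R u v ∧ u ≠ v ∧ ∀ w, R u w → R w v → w = u ∨ w = v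

namespace IsForestOrder

variable {V : Type*} {R : V → V → Prop}

theorem covers_unique (hR : IsForestOrder R) {u u' v : V} (h : RelCovers R u v)
    (h' : RelCovers R u' v) : u = u' := by
  rcases hR.chain h.1 h'.1 with huu | huu
  · rcases h.2.2 u' huu h'.1 with e | e
    · exact e.symm
    · exact absurd e h'.2.1
  · rcases h'.2.2 u huu h.1 with e | e
    · exact e
    · exact absurd e h.2.1

/-- The number of elements below `v`. -/
noncomputable def height (R : V → V → Prop) (v : V) : ℕ := {u | R u v}.ncard

/-- The graph joining each element to the element immediately below it. -/
def coverGraph (R : V → V → Prop) : SimpleGraph V where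
  Adj u v := RelCovers R u v ∨ RelCovers R v u
  symm := ⟨fun _ _ h => Or.symm h⟩
  loopless := ⟨fun _ h => h.elim (fun h => h.2.1 rfl) fun h => h.2.1 rfl⟩

/-- Lying above a fixed minimal element is unchanged along each cover edge, hence constant on
components. This gives uniqueness of the root in `toForest`. -/
theorem minimal_rel_iff_of_reachable (hR : IsForestOrder R) {r : V} (hr : ∀ u, R u r → u = r)
    {u v : V} (h : (coverGraph R).Reachable u v) : R r u ↔ R r v := by
  have step : ∀ x y, RelCovers R x y → (R r x ↔ R r y) := by
    intro x y hxy
    refine ⟨fun h => hR.trans h hxy.1, fun h => ?_⟩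
    rcases hR.chain h hxy.1 with h | h
    · exact h
    · rw [hr x h]; exact hR.refl r
  obtain ⟨p⟩ := h
  induction p with
  | nil => exact Iff.rfl
  | cons hadj _ ih =>
    refine Iff.trans ?_ ih
    rcases hadj with h | h
    · exact step _ _ h
    · exact (step _ _ h).symm

variable [Finite V]

theorem height_lt (hR : IsForestOrder R) {u v : V} (h : R u v) (hne : u ≠ v) :
    height R u < height R v := by
  refine Set.ncard_lt_ncard ⟨fun w hw => hR.trans hw h, fun hsub => ?_⟩ (Set.toFinite _)
  exact hne (hR.antisymm h (hsub (hR.refl v)))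

theorem exists_covers (hR : IsForestOrder R) {u v : V} (h : R u v) (hne : u ≠ v) :
    ∃ w, R u w ∧ RelCovers R w v := by
  obtain ⟨w, ⟨hw, hwne, huw⟩, hmax⟩ := Set.exists_max_image {w | R w v ∧ w ≠ v ∧ R u w} (height R)
    (Set.toFinite _) ⟨u, h, hne, hR.refl u⟩
  refine ⟨w, huw, hw, hwne, fun x hwx hxv => ?_⟩
  by_contra! hx
  exact absurd (hmax x ⟨hxv, hx.2, hR.trans huw hwx⟩)
    (not_le.2 (hR.height_lt hwx (Ne.symm hx.1)))

theorem exists_minimal (hR : IsForestOrder R) (v : V) :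
    ∃ r, (∀ u, R u r → u = r) ∧ R r v := by
  obtain ⟨r, hr, hmin⟩ := Set.exists_min_image {w | R w v} (height R) (Set.toFinite _)
    ⟨v, hR.refl v⟩
  refine ⟨r, fun u hu => ?_, hr⟩
  by_contra hne
  exact absurd (hmin u (hR.trans hu hr)) (not_le.2 (hR.height_lt hu hne))

theorem coverGraph_isAcyclic (hR : IsForestOrder R) : (coverGraph R).IsAcyclic := by
  classical
  intro v c hc
  -- At a highest vertex of a cycle both cycle neighbours are covered by it, so they coincide,
  -- whereas the two neighbours on a cycle are distinct.
  obtain ⟨w, hw, hmax⟩ := Set.exists_max_image {w | w ∈ c.support} (height R)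
    (Set.toFinite _) ⟨v, c.start_mem_support⟩
  have hd := hc.rotate hw
  have hnn := hd.not_nil
  have key : ∀ x, x ∈ (c.rotate w hw).support → (coverGraph R).Adj w x → RelCovers R x w := by
    intro x hx hadj
    rcases hadj with h | h
    · exact absurd (hmax x ((SimpleGraph.Walk.mem_support_rotate_iff _ _ _).1 hx))
        (not_le.2 (hR.height_lt h.1 h.2.1))
    · exact h
  refine hd.snd_ne_penultimate (hR.covers_unique (key _ ?_ ?_) (key _ ?_ ?_))
  · exact SimpleGraph.Walk.getVert_mem_support _ _
  · exact SimpleGraph.Walk.adj_snd hnn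
  · exact SimpleGraph.Walk.getVert_mem_support _ _
  · exact (SimpleGraph.Walk.adj_penultimate hnn).symm

theorem reachable_of_rel (hR : IsForestOrder R) (u : V) :
    ∀ v, R u v → (coverGraph R).Reachable u v := by
  suffices ∀ n v, height R v = n → R u v → (coverGraph R).Reachable u v from
    fun v => this _ v rfl
  intro n
  induction n using Nat.strong_induction_on with
  | _ n ih =>
    intro v hv huv
    by_cases hne : u = v
    · rw [hne]
    · obtain ⟨w, huw, hw⟩ := hR.exists_covers huv hne
      have := ih _ (hv ▸ hR.height_lt hw.1 hw.2.1) w rfl huw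
      exact this.trans (SimpleGraph.Adj.reachable (Or.inl hw))

/-- The rooted forest with a given ancestor relation. -/
def toForest (hR : IsForestOrder R) : RootedForest V where
  graph := coverGraph R
  acyclic := hR.coverGraph_isAcyclic
  roots := {r | ∀ u, R u r → u = r}
  existsUnique_root v := by
    obtain ⟨r, hr, hrv⟩ := hR.exists_minimal v
    refine ⟨r, ⟨hr, hR.reachable_of_rel r v hrv⟩, ?_⟩
    rintro s ⟨hs, hsv⟩
    have hsv' := (hR.minimal_rel_iff_of_reachable hs hsv).1 (hR.refl s)
    rcases hR.chain hrv hsv' with h | h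
    · exact (hs r h).symm
    · exact hr s h

end IsForestOrder

/-! ### Rooted forests recovered from their ancestor relations -/

namespace RootedForest

variable {V : Type*} (F : RootedForest V)

theorem exists_rootPath (v : V) :
    ∃ r ∈ F.roots, ∃ p : F.graph.Walk r v, p.IsPath := by
  classical
  obtain ⟨r, ⟨hr, ⟨p⟩⟩, -⟩ := F.existsUnique_root v
  exact ⟨r, hr, p.bypass, p.bypass_isPath⟩

/-- Both the root of a component and the path between two vertices of an acyclic graph are unique,
so any root path tests ancestry. -/
theorem isAncestor_iff_mem_support {r u v : V} (hr : r ∈ F.roots) {p : F.graph.Walk r v}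
    (hp : p.IsPath) : F.IsAncestor u v ↔ u ∈ p.support := by
  refine ⟨?_, fun h => ⟨r, hr, p, hp, h⟩⟩
  rintro ⟨s, hs, q, hq, hu⟩
  obtain rfl := (F.existsUnique_root v).unique ⟨hr, ⟨p⟩⟩ ⟨hs, ⟨q⟩⟩
  have := F.acyclic.subsingleton_path r v
  have hpq := congrArg Subtype.val (Subsingleton.elim (⟨p, hp⟩ : F.graph.Path r v) ⟨q, hq⟩)
  simp only at hpq
  rwa [hpq]

theorem isForestOrder_isAncestor : IsForestOrder F.IsAncestor := by
  classical
  refine ⟨fun v => ?_, fun {u v w} huv hvw => ?_, fun {u v} huv hvu => ?_,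
    fun {u v w} huw hvw => ?_⟩
  · obtain ⟨r, hr, p, hp⟩ := F.exists_rootPath v
    exact ⟨r, hr, p, hp, p.end_mem_support⟩
  · obtain ⟨r, hr, p, hp, hv⟩ := hvw
    rw [F.isAncestor_iff_mem_support hr (hp.takeUntil hv)] at huv
    exact ⟨r, hr, p, hp, p.support_takeUntil_subset_support hv huv⟩
  · by_contra hne
    obtain ⟨r, hr, p, hp, hu⟩ := huv
    rw [F.isAncestor_iff_mem_support hr (hp.takeUntil hu)] at hvu
    exact SimpleGraph.Walk.endpoint_notMem_support_takeUntil hp hu (Ne.symm hne) hvu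
  · obtain ⟨r, hr, p, hp, hu⟩ := huw
    have hv := (F.isAncestor_iff_mem_support hr hp).1 hvw
    -- The root paths to `u` and `v` are initial segments of the same path to `w`, so one is a
    -- prefix of the other.
    rcases List.prefix_or_prefix_of_prefix (p.support_takeUntil_prefix_support hu)
      (p.support_takeUntil_prefix_support hv) with h | h
    · exact Or.inl ⟨r, hr, _, hp.takeUntil hv, h.subset (SimpleGraph.Walk.end_mem_support _)⟩
    · exact Or.inr ⟨r, hr, _, hp.takeUntil hu, h.subset (SimpleGraph.Walk.end_mem_support _)⟩

/-- When `v` is off the root path of `w`, appending the edge to that path gives the root path of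
`v`. -/
theorem isAncestor_adj_iff {w v : V} (hadj : F.graph.Adj w v) (hv : ¬ F.IsAncestor v w) (u : V) :
    F.IsAncestor u v ↔ F.IsAncestor u w ∨ u = v := by
  obtain ⟨r, hr, p, hp⟩ := F.exists_rootPath w
  rw [F.isAncestor_iff_mem_support hr hp] at hv ⊢
  rw [F.isAncestor_iff_mem_support hr (hp.concat hv hadj)]
  simp [SimpleGraph.Walk.support_concat]

theorem relCovers_of_adj {w v : V} (hadj : F.graph.Adj w v) (hv : ¬ F.IsAncestor v w) :
    RelCovers F.IsAncestor w v := by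
  have hF := F.isForestOrder_isAncestor
  have h := F.isAncestor_adj_iff hadj hv
  refine ⟨(h w).2 (Or.inl (hF.refl w)), hadj.ne, fun x hwx hxv => ?_⟩
  rcases (h x).1 hxv with hx | hx
  · exact Or.inl (hF.antisymm hx hwx)
  · exact Or.inr hx

theorem adj_iff (u v : V) :
    F.graph.Adj u v ↔ RelCovers F.IsAncestor u v ∨ RelCovers F.IsAncestor v u := by
  have hF := F.isForestOrder_isAncestor
  have adj_of : ∀ u v, RelCovers F.IsAncestor u v → F.graph.Adj u v := by
    intro u v h
    obtain ⟨r, hr, p, hp, hu⟩ := h.1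
    have hnn : ¬ p.Nil := by
      intro hn
      rw [SimpleGraph.Walk.nil_iff_support_eq.1 hn, List.mem_singleton] at hu
      exact h.2.1 (hu.trans hn.eq)
    have hadj := SimpleGraph.Walk.adj_penultimate hnn
    have hpv : F.IsAncestor p.penultimate v :=
      ⟨r, hr, p, hp, SimpleGraph.Walk.getVert_mem_support _ _⟩
    have hnot : ¬ F.IsAncestor v p.penultimate := fun h' => hadj.ne (hF.antisymm hpv h')
    rcases (F.isAncestor_adj_iff hadj hnot u).1 h.1 with hx | hx
    · rcases h.2.2 _ hx hpv with e | e
      · rwa [e] at hadj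
      · exact absurd e hadj.ne
    · exact absurd hx h.2.1
  refine ⟨fun hadj => ?_, fun h => h.elim (adj_of u v) fun h => (adj_of v u h).symm⟩
  by_cases hvu : F.IsAncestor v u
  · exact Or.inr (F.relCovers_of_adj hadj.symm fun h => hadj.ne (hF.antisymm h hvu))
  · exact Or.inl (F.relCovers_of_adj hadj hvu)

theorem mem_roots_iff (r : V) : r ∈ F.roots ↔ ∀ u, F.IsAncestor u r → u = r := by
  constructor
  · intro hr u hu
    simpa using (F.isAncestor_iff_mem_support hr (SimpleGraph.Walk.IsPath.nil (u := r))).1 hu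
  · intro h
    obtain ⟨s, hs, p, hp⟩ := F.exists_rootPath r
    rwa [← h s ⟨s, hs, p, hp, p.start_mem_support⟩]

theorem isAncestor_injective :
    Function.Injective (IsAncestor : RootedForest V → V → V → Prop) := by
  intro F G h
  ext u v
  · rw [F.adj_iff, G.adj_iff, h]
  · rw [F.mem_roots_iff, G.mem_roots_iff, h]

theorem isTree_iff : F.IsTree ↔ ∃ r, ∀ v, F.IsAncestor r v := by
  constructor
  · intro h
    obtain ⟨v⟩ := h.nonempty
    obtain ⟨r, hr, -⟩ := F.exists_rootPath v
    refine ⟨r, fun w => ?_⟩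
    obtain ⟨s, hs, q, hq⟩ := F.exists_rootPath w
    obtain rfl := (F.existsUnique_root w).unique ⟨hr, h.preconnected r w⟩ ⟨hs, ⟨q⟩⟩
    exact ⟨r, hr, q, hq, q.start_mem_support⟩
  · rintro ⟨r, hr⟩
    classical
    have key : ∀ v, F.graph.Reachable r v := by
      intro v
      obtain ⟨s, hs, p, hp, hmem⟩ := hr v
      exact ⟨p.dropUntil r hmem⟩
    have : Nonempty V := ⟨r⟩
    exact SimpleGraph.Connected.mk fun u v => (key u).symm.trans (key v)

/-- A rooted forest is determined by its parent function. -/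
theorem relCovers_injective [Finite V] :
    Function.Injective fun (F : RootedForest V) => RelCovers F.IsAncestor := by
  intro F G h
  simp only at h
  have roots : ∀ (F : RootedForest V) r, r ∈ F.roots ↔ ∀ u, ¬ RelCovers F.IsAncestor u r := by
    intro F r
    rw [F.mem_roots_iff]
    refine ⟨fun hr u hu => hu.2.1 (hr u hu.1), fun hr u hu => ?_⟩
    by_contra hne
    obtain ⟨w, -, hw⟩ := F.isForestOrder_isAncestor.exists_covers hu hne
    exact hr w hw
  ext u v
  · rw [F.adj_iff, G.adj_iff, h]
  · rw [roots, roots, h]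

open Classical in
theorem card_le (n : ℕ) : Nat.card (RootedForest (Fin n)) ≤ (n + 1) ^ n := by
  -- The value `none` marks the roots, so each vertex has `n + 1` possible values.
  let par : RootedForest (Fin n) → Fin n → Option (Fin n) := fun F v =>
    if h : ∃ u, RelCovers F.IsAncestor u v then some h.choose else none
  have hpar : ∀ F u v, par F v = some u ↔ RelCovers F.IsAncestor u v := by
    intro F u v
    by_cases h : ∃ u, RelCovers F.IsAncestor u v
    · simp only [par, dif_pos h, Option.some.injEq]
      constructor
      · rintro rfl
        exact h.choose_spec
      · intro h'
        exact F.isForestOrder_isAncestor.covers_unique h.choose_spec h'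
    · simp only [par, dif_neg h, reduceCtorEq, false_iff]
      exact fun h' => h ⟨u, h'⟩
  have hinj : Function.Injective par := by
    intro F G h
    apply relCovers_injective
    funext u v
    simp only [← hpar, h]
  simpa using Nat.card_le_card_of_injective par hinj

end RootedForest

namespace IsForestOrder

variable {V : Type*} {R : V → V → Prop} [Finite V]

/-- Induction on height: in both relations the elements below `v` are `v` itself and those below the
unique element that `v` covers. -/
theorem isAncestor_toForest (hR : IsForestOrder R) : hR.toForest.IsAncestor = R := by
  suffices ∀ n v, height R v = n → ∀ u, hR.toForest.IsAncestor u v ↔ R u v by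
    funext u v
    exact propext (this _ v rfl u)
  intro n
  induction n using Nat.strong_induction_on with
  | _ n ih =>
    intro v hv u
    by_cases hmin : ∀ u, R u v → u = v
    · have h := (hR.toForest.mem_roots_iff v).1 hmin
      constructor
      · intro hu
        rw [h u hu]
        exact hR.refl v
      · intro hu
        rw [hmin u hu]
        exact hR.toForest.isForestOrder_isAncestor.refl v
    · push Not at hmin
      obtain ⟨x, hx, hxne⟩ := hmin
      obtain ⟨w, -, hw⟩ := hR.exists_covers hx hxne
      have ihw := ih _ (hv ▸ hR.height_lt hw.1 hw.2.1) w rfl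
      have hadj : hR.toForest.graph.Adj w v := Or.inl hw
      rw [hR.toForest.isAncestor_adj_iff hadj, ihw]
      · constructor
        · rintro (h | rfl)
          · exact hR.trans h hw.1
          · exact hR.refl _
        · intro h
          by_cases hne : u = v
          · exact Or.inr hne
          · obtain ⟨w', huw', hw'⟩ := hR.exists_covers h hne
            rw [hR.covers_unique hw hw']
            exact Or.inl huw'
      · rw [ihw]
        exact fun h => hw.2.1 (hR.antisymm hw.1 h)

end IsForestOrder

/-- A rooted forest amounts to its ancestor relation. -/
noncomputable def RootedForest.equivForestOrder (V : Type*) [Finite V] :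
    RootedForest V ≃ {R : V → V → Prop // IsForestOrder R} where
  toFun F := ⟨F.IsAncestor, F.isForestOrder_isAncestor⟩
  invFun R := R.2.toForest
  left_inv _ := RootedForest.isAncestor_injective (IsForestOrder.isAncestor_toForest _)
  right_inv _ := Subtype.ext (IsForestOrder.isAncestor_toForest _)

/-! ### Counting avoiding forests through their orders -/

/-- No chain of the relation `R` is order isomorphic to a pattern of `S`. -/
def RelAvoids {V : Type*} [LinearOrder V] (R : V → V → Prop) (S : Set Pattern) : Prop :=
  ∀ π ∈ S, ∀ v : Fin (π.1 + 1) → V, (∀ i : Fin π.1, R (v i.castSucc) (v i.succ)) →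
    ¬ ∀ i j : Fin (π.1 + 1), v i < v j ↔ π.2 i < π.2 j

theorem RootedForest.avoids_iff {V : Type*} [LinearOrder V] (F : RootedForest V)
    (S : Set Pattern) : F.Avoids S ↔ RelAvoids F.IsAncestor S := by
  simp only [RootedForest.Avoids, RelAvoids, RootedForest.IsInstance, not_exists, not_and]

/-- The ancestor relations of the rooted forests on `V` that avoid `S`. -/
abbrev AvoidingOrder (S : Set Pattern) (V : Type*) [LinearOrder V] : Type _ :=
  {R : V → V → Prop // IsForestOrder R ∧ RelAvoids R S}

/-- The ancestor relations of the rooted trees on `V` that avoid `S`. -/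
abbrev AvoidingTreeOrder (S : Set Pattern) (V : Type*) [LinearOrder V] : Type _ :=
  {R : V → V → Prop // IsForestOrder R ∧ (∃ r, ∀ v, R r v) ∧ RelAvoids R S}

theorem numForests_eq (S : Set Pattern) (n : ℕ) :
    numForests S n = Nat.card (AvoidingOrder S (Fin n)) := by
  refine Nat.card_congr (((RootedForest.equivForestOrder (Fin n)).subtypeEquiv
    (q := fun R => RelAvoids R.1 S) fun F => ?_).trans
    (Equiv.subtypeSubtypeEquivSubtypeInter _ fun R => RelAvoids R S))
  exact F.avoids_iff S

theorem numTrees_eq (S : Set Pattern) (n : ℕ) :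
    numTrees S n = Nat.card (AvoidingTreeOrder S (Fin n)) := by
  refine Nat.card_congr (((RootedForest.equivForestOrder (Fin n)).subtypeEquiv
    (q := fun R => (∃ r, ∀ v, R.1 r v) ∧ RelAvoids R.1 S) fun F => ?_).trans
    (Equiv.subtypeSubtypeEquivSubtypeInter _ fun R => (∃ r, ∀ v, R r v) ∧ RelAvoids R S))
  exact and_congr F.isTree_iff (F.avoids_iff S)

theorem numTrees_le_numForests (S : Set Pattern) (n : ℕ) : numTrees S n ≤ numForests S n :=
  Nat.card_le_card_of_injective (fun F => ⟨F.1, F.2.2⟩) fun F G h => by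
    simpa [Subtype.ext_iff] using h

theorem numForests_le (S : Set Pattern) (n : ℕ) : numForests S n ≤ (n + 1) ^ n :=
  (Nat.card_le_card_of_injective Subtype.val Subtype.val_injective).trans (RootedForest.card_le n)

theorem IsForestOrder.comap {V W : Type*} {R : W → W → Prop} (hR : IsForestOrder R) {f : V → W}
    (hf : Function.Injective f) : IsForestOrder fun x y => R (f x) (f y) :=
  ⟨fun _ => hR.refl _, hR.trans, fun h h' => hf (hR.antisymm h h'), hR.chain⟩

theorem IsForestOrder.rel_zero {V : Type*} {R : V → V → Prop} (hR : IsForestOrder R) {k : ℕ}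
    {v : Fin (k + 1) → V} (h : ∀ i : Fin k, R (v i.castSucc) (v i.succ)) (i : Fin (k + 1)) :
    R (v 0) (v i) := by
  induction i using Fin.induction with
  | zero => exact hR.refl _
  | succ i ih => exact hR.trans ih (h i)

/-- An instance contained in an order-preserving copy of an avoiding relation would pull back to
that relation. -/
theorem RelAvoids.not_instance_of_range {V W : Type*} [LinearOrder V] [LinearOrder W]
    {P : V → V → Prop} {S : Set Pattern} (hP : RelAvoids P S) {R : W → W → Prop} {g : V → W}
    (hg : StrictMono g) (hPR : ∀ a b, R (g a) (g b) → P a b) {π : Pattern} (hπ : π ∈ S)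
    {v : Fin (π.1 + 1) → W} (hv : ∀ i : Fin π.1, R (v i.castSucc) (v i.succ))
    (hrange : ∀ i, ∃ a, g a = v i) : ¬ ∀ i j : Fin (π.1 + 1), v i < v j ↔ π.2 i < π.2 j := by
  choose w hw using hrange
  intro h
  refine hP π hπ w (fun i => hPR _ _ ?_) fun i j => ?_
  · rw [hw, hw]
    exact hv i
  · rw [← h, ← hw, ← hw, hg.lt_iff_lt]

/-! ### Grafting a forest onto a new smallest root -/

section Graft

variable {A B : Type*}

/-- The disjoint union of a forest on `A` with the tree obtained by joining a new root to a
forest on `B`, as ancestor relations. -/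
def graft (P : A → A → Prop) (Q : B → B → Prop) : A ⊕ Option B → A ⊕ Option B → Prop
  | .inl a, .inl a' => P a a'
  | .inr none, .inr _ => True
  | .inr (some b), .inr (some b') => Q b b'
  | _, _ => False

theorem isForestOrder_graft {P : A → A → Prop} {Q : B → B → Prop} (hP : IsForestOrder P)
    (hQ : IsForestOrder Q) : IsForestOrder (graft P Q) := by
  refine ⟨?_, ?_, ?_, ?_⟩
  · rintro (a | _ | b) <;> simp [graft, hP.refl, hQ.refl]
  · rintro (a | _ | b) (a' | _ | b') (a'' | _ | b'') <;> simp only [graft, false_implies,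
      implies_true, imp_self]
    · exact hP.trans
    · exact hQ.trans
  · rintro (a | _ | b) (a' | _ | b') <;> simp only [graft, false_implies, implies_true,
      Sum.inl.injEq, Sum.inr.injEq, Option.some.injEq]
    · exact hP.antisymm
    · exact hQ.antisymm
  · rintro (a | _ | b) (a' | _ | b') (a'' | _ | b'') <;> simp only [graft, false_implies,
      implies_true, true_or, or_true]
    · exact hP.chain
    · exact hQ.chain

/-- The relabelling of `A ⊕ Option B` that gives the label `0` to the new root. -/
def graftEquiv {N : ℕ} (e : A ⊕ B ≃ Fin N) : A ⊕ Option B ≃ Fin (N + 1) where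
  toFun
    | .inl a => (e (.inl a)).succ
    | .inr none => 0
    | .inr (some b) => (e (.inr b)).succ
  invFun := Fin.cases (.inr none) fun i => Sum.map id some (e.symm i)
  left_inv := by rintro (a | _ | b) <;> simp
  right_inv := by
    intro x
    induction x using Fin.cases with
    | zero => simp
    | succ i =>
      obtain ⟨y, rfl⟩ := e.surjective i
      rcases y with a | b <;> simp

theorem graftEquiv_inl {N : ℕ} (e : A ⊕ B ≃ Fin N) (a : A) :
    graftEquiv e (.inl a) = (e (.inl a)).succ := rfl

theorem graftEquiv_none {N : ℕ} (e : A ⊕ B ≃ Fin N) : graftEquiv e (.inr none) = 0 := rfl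

theorem graftEquiv_some {N : ℕ} (e : A ⊕ B ≃ Fin N) (b : B) :
    graftEquiv e (.inr (some b)) = (e (.inr b)).succ := rfl

/-- The forest `graft P Q`, relabelled by `Fin (N + 1)` with the new root labelled `0`. -/
def relabeledGraft {N : ℕ} (e : A ⊕ B ≃ Fin N) (P : A → A → Prop) (Q : B → B → Prop)
    (x y : Fin (N + 1)) : Prop :=
  graft P Q ((graftEquiv e).symm x) ((graftEquiv e).symm y)

variable {P : A → A → Prop} {Q : B → B → Prop} {N : ℕ} {e : A ⊕ B ≃ Fin N}

theorem relabeledGraft_injective {P' : A → A → Prop} {Q' : B → B → Prop}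
    (h : relabeledGraft e P Q = relabeledGraft e P' Q') : P = P' ∧ Q = Q' := by
  constructor
  · funext a a'
    have := congrFun (congrFun h (graftEquiv e (.inl a))) (graftEquiv e (.inl a'))
    simpa only [relabeledGraft, Equiv.symm_apply_apply, graft] using this
  · funext b b'
    have := congrFun (congrFun h (graftEquiv e (.inr (some b)))) (graftEquiv e (.inr (some b')))
    simpa only [relabeledGraft, Equiv.symm_apply_apply, graft] using this

theorem relabeledGraft_zero_succ (i : Fin N) :
    relabeledGraft e P Q 0 i.succ ↔ ∃ b, e (.inr b) = i := by
  obtain ⟨y, rfl⟩ := e.surjective i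
  rcases y with a | b
  · rw [relabeledGraft, ← graftEquiv_none e, ← graftEquiv_inl, Equiv.symm_apply_apply,
      Equiv.symm_apply_apply]
    simp [graft]
  · rw [relabeledGraft, ← graftEquiv_none e, ← graftEquiv_some, Equiv.symm_apply_apply,
      Equiv.symm_apply_apply]
    simp [graft]

variable [LinearOrder A] [LinearOrder B] {S : Set Pattern}

theorem relAvoids_relabeledGraft (hP : IsForestOrder P) (hQ : IsForestOrder Q)
    (hPS : RelAvoids P S) (hQS : RelAvoids Q S) (hS : ∀ π ∈ S, ¬ π.BeginsWithSmallest)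
    (hA : StrictMono fun a => e (.inl a)) (hB : StrictMono fun b => e (.inr b)) :
    RelAvoids (relabeledGraft e P Q) S := by
  intro π hπ v hv hlt
  have hR : IsForestOrder (relabeledGraft e P Q) :=
    (isForestOrder_graft hP hQ).comap (graftEquiv e).symm.injective
  have h0 := fun i => hR.rel_zero hv i
  -- All vertices of the instance lie below the first one in the tree, so the position of `v 0`
  -- decides which piece contains the whole instance.
  obtain ⟨x, hx⟩ := (graftEquiv e).surjective (v 0)
  simp only [relabeledGraft, ← hx, Equiv.symm_apply_apply] at h0
  rcases x with a | _ | b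
  · refine hPS.not_instance_of_range (R := relabeledGraft e P Q)
      (g := fun a => graftEquiv e (.inl a)) ?_ ?_ hπ hv ?_ hlt
    · exact fun a a' h => Fin.succ_lt_succ_iff.2 (hA h)
    · intro a a' h
      simpa only [relabeledGraft, Equiv.symm_apply_apply, graft] using h
    · intro i
      obtain ⟨y, hy⟩ := (graftEquiv e).surjective (v i)
      have := h0 i
      rw [← hy, Equiv.symm_apply_apply] at this
      rcases y with a' | y
      · exact ⟨a', hy⟩
      · simp [graft] at this
  -- The first vertex is the new root, whose label `0` is least; were `π.2 0` not the least value,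
  -- the vertex playing the value `0` would need a label below `0`.
  · refine hS π hπ ?_
    by_contra hne
    have hlt' : π.2 (π.2.symm 0) < π.2 0 := by
      rw [Equiv.apply_symm_apply]
      exact Fin.pos_iff_ne_zero.2 hne
    rw [← hlt, ← hx, graftEquiv_none] at hlt'
    exact absurd hlt' (Fin.not_lt_zero _)
  · refine hQS.not_instance_of_range (R := relabeledGraft e P Q)
      (g := fun b => graftEquiv e (.inr (some b))) ?_ ?_ hπ hv ?_ hlt
    · exact fun a a' h => Fin.succ_lt_succ_iff.2 (hB h)
    · intro a a' h
      simpa only [relabeledGraft, Equiv.symm_apply_apply, graft] using h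
    · intro i
      obtain ⟨y, hy⟩ := (graftEquiv e).surjective (v i)
      have := h0 i
      rw [← hy, Equiv.symm_apply_apply] at this
      rcases y with a' | _ | b'
      · simp [graft] at this
      · simp [graft] at this
      · exact ⟨b', hy⟩

/-- `relabeledGraft` as a map between the relations that avoid `S`. -/
def avoidingGraft (hS : ∀ π ∈ S, ¬ π.BeginsWithSmallest) (e : A ⊕ B ≃ Fin N)
    (hA : StrictMono fun a => e (.inl a)) (hB : StrictMono fun b => e (.inr b))
    (P : AvoidingOrder S A) (Q : AvoidingOrder S B) : AvoidingOrder S (Fin (N + 1)) :=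
  ⟨relabeledGraft e P.1 Q.1,
    (isForestOrder_graft P.2.1 Q.2.1).comap (graftEquiv e).symm.injective,
    relAvoids_relabeledGraft P.2.1 Q.2.1 P.2.2 Q.2.2 hS hA hB⟩

end Graft

/-- Choose the labels of two forests on `m` and `n` vertices among the nonzero labels, and join
the root `0` to the second. -/
theorem choose_mul_numForests_le {S : Set Pattern} (hS : ∀ π ∈ S, ¬ π.BeginsWithSmallest)
    (m n : ℕ) :
    (m + n).choose m * (numForests S m * numForests S n) ≤ numForests S (m + n + 1) := by
  have hcompl : ∀ s : {s : Finset (Fin (m + n)) // s.card = m}, (s.1ᶜ).card = n := by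
    intro s
    rw [Finset.card_compl, s.2, Fintype.card_fin, Nat.add_sub_cancel_left]
  let e : {s : Finset (Fin (m + n)) // s.card = m} → (Fin m ⊕ Fin n ≃ Fin (m + n)) :=
    fun s => finSumEquivOfFinset s.2 (hcompl s)
  have he : ∀ s i, (∃ b, e s (.inr b) = i) ↔ i ∉ s.1 := by
    intro s i
    simp only [e, finSumEquivOfFinset_inr]
    rw [← Set.mem_range, Finset.range_orderEmbOfFin]
    simp
  let Φ : {s : Finset (Fin (m + n)) // s.card = m} × AvoidingOrder S (Fin m) ×
      AvoidingOrder S (Fin n) → AvoidingOrder S (Fin (m + n + 1)) := fun x =>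
    avoidingGraft hS (e x.1)
      (fun a b h => by simpa only [e, finSumEquivOfFinset_inl] using
        (Finset.orderEmbOfFin _ _).strictMono h)
      (fun a b h => by simpa only [e, finSumEquivOfFinset_inr] using
        (Finset.orderEmbOfFin _ _).strictMono h) x.2.1 x.2.2
  have hΦ : Function.Injective Φ := by
    rintro ⟨s, P, Q⟩ ⟨s', P', Q'⟩ h
    have h' : relabeledGraft (e s) P.1 Q.1 = relabeledGraft (e s') P'.1 Q'.1 :=
      congrArg Subtype.val h
    -- The labels outside `s` are exactly the nonroot descendants of `0`, so the relation determines
    -- `s`.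
    obtain rfl : s = s' := by
      ext i
      rw [← not_iff_not, ← he, ← he, ← relabeledGraft_zero_succ (P := P.1) (Q := Q.1), h',
        relabeledGraft_zero_succ]
    obtain ⟨h1, h2⟩ := relabeledGraft_injective h'
    rw [Subtype.ext h1, Subtype.ext h2]
  have := Nat.card_le_card_of_injective Φ hΦ
  rwa [Nat.card_prod, Nat.card_prod, ← numForests_eq, ← numForests_eq, ← numForests_eq,
    Nat.card_eq_fintype_card, Fintype.card_finset_len, Fintype.card_fin] at this

/-- Grafting with an empty first forest leaves a single tree with root `0`. -/
theorem numForests_le_numTrees_succ {S : Set Pattern} (hS : ∀ π ∈ S, ¬ π.BeginsWithSmallest)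
    (n : ℕ) : numForests S n ≤ numTrees S (n + 1) := by
  rw [numForests_eq, numTrees_eq]
  let e : Fin 0 ⊕ Fin n ≃ Fin n := Equiv.emptySum (Fin 0) (Fin n)
  let P : AvoidingOrder S (Fin 0) := ⟨fun _ _ => True,
    ⟨fun a => a.elim0, fun {a} => a.elim0, fun {a} => a.elim0, fun {a} => a.elim0⟩,
    fun _ _ v => (v 0).elim0⟩
  let Φ : AvoidingOrder S (Fin n) → AvoidingTreeOrder S (Fin (n + 1)) := fun Q =>
    ⟨relabeledGraft e P.1 Q.1,
      (avoidingGraft hS e (fun a => a.elim0) (fun a b h => h) P Q).2.1, ⟨0, fun v => by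
      obtain ⟨y, rfl⟩ := (graftEquiv e).surjective v
      rcases y with a | y
      · exact a.elim0
      · rw [relabeledGraft, ← graftEquiv_none e, Equiv.symm_apply_apply,
          Equiv.symm_apply_apply]
        simp [graft]⟩, (avoidingGraft hS e (fun a => a.elim0) (fun a b h => h) P Q).2.2⟩
  refine Nat.card_le_card_of_injective Φ fun Q Q' h => ?_
  exact Subtype.ext (relabeledGraft_injective (congrArg Subtype.val h)).2

theorem numForests_pos {S : Set Pattern} (hS : ∀ π ∈ S, ¬ π.BeginsWithSmallest) (n : ℕ) :
    0 < numForests S n := by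
  induction n with
  | zero =>
    rw [numForests_eq]
    have : Nonempty (AvoidingOrder S (Fin 0)) := ⟨⟨fun _ _ => True,
      ⟨fun a => a.elim0, fun {a} => a.elim0, fun {a} => a.elim0, fun {a} => a.elim0⟩,
      fun _ _ v => (v 0).elim0⟩⟩
    exact Nat.card_pos
  | succ n ih =>
    exact ih.trans_le ((numForests_le_numTrees_succ hS n).trans (numTrees_le_numForests S _))

/-! ### Complementation symmetry -/

/-- The complement of a pattern. -/
def Pattern.compl (π : Pattern) : Pattern := ⟨π.1, π.2.trans Fin.revPerm⟩

theorem Pattern.compl_compl (π : Pattern) : π.compl.compl = π := by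
  refine Sigma.ext rfl (heq_of_eq ?_)
  exact Equiv.ext fun i => Fin.rev_rev (π.2 i)

theorem RelAvoids.compl {n : ℕ} {R : Fin n → Fin n → Prop} {S : Set Pattern}
    (h : RelAvoids R S) :
    RelAvoids (fun x y => R (Fin.rev x) (Fin.rev y)) {π | π.compl ∈ S} := by
  intro π hπ v hv hlt
  refine h _ hπ (fun i => Fin.rev (v i)) hv fun i j => ?_
  exact Fin.rev_lt_rev.trans ((hlt j i).trans Fin.rev_lt_rev.symm)

theorem compl_preimage_preimage (S : Set Pattern) :
    {π : Pattern | π.compl ∈ {π : Pattern | π.compl ∈ S}} = S := by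
  ext π
  simp [Pattern.compl_compl]

theorem rel_rev_injective (n : ℕ) :
    Function.Injective fun (R : Fin n → Fin n → Prop) x y => R (Fin.rev x) (Fin.rev y) := by
  intro R R' h
  funext x y
  simpa using congrFun (congrFun h x.rev) y.rev

theorem numForests_compl (S : Set Pattern) (n : ℕ) :
    numForests {π | π.compl ∈ S} n = numForests S n := by
  have key : ∀ S, numForests S n ≤ numForests {π | π.compl ∈ S} n := by
    intro S
    rw [numForests_eq, numForests_eq]
    refine Nat.card_le_card_of_injective
      (fun R => ⟨_, R.2.1.comap Fin.rev_injective, R.2.2.compl⟩) fun R R' h => ?_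
    exact Subtype.ext (rel_rev_injective n (congrArg Subtype.val h))
  -- Complementation is an involution, so the inequality for the complemented set is the reverse
  -- one.
  refine le_antisymm ((key _).trans_eq ?_) (key S)
  rw [compl_preimage_preimage]

theorem numTrees_compl (S : Set Pattern) (n : ℕ) :
    numTrees {π | π.compl ∈ S} n = numTrees S n := by
  have key : ∀ S, numTrees S n ≤ numTrees {π | π.compl ∈ S} n := by
    intro S
    rw [numTrees_eq, numTrees_eq]
    refine Nat.card_le_card_of_injective
      (fun R => ⟨_, R.2.1.comap Fin.rev_injective, ?_, R.2.2.2.compl⟩) fun R R' h => ?_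
    · obtain ⟨r, hr⟩ := R.2.2.1
      exact ⟨r.rev, fun v => by simpa using hr v.rev⟩
    · exact Subtype.ext (rel_rev_injective n (congrArg Subtype.val h))
  refine le_antisymm ((key _).trans_eq ?_) (key S)
  rw [compl_preimage_preimage]

/-! ### Fekete's lemma with a logarithmic error -/

section AlmostSuperadditive

variable {c : ℕ → ℝ}

/-- The surplus `log (16 * p) + 2 * log k` makes the induction close: splitting `k = i + j` yields
it twice, and after paying `log (k * p)` one copy remains as soon as `k ^ 3 ≤ 16 * (i * j) ^ 2`,
which holds for nearly equal halves. -/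
theorem le_apply_mul_of_almost_superadditive
    (hc : ∀ p q, 0 < p → 0 < q → c p + c q - Real.log ((p + q : ℕ) : ℝ) ≤ c (p + q))
    {p : ℕ} (hp : 0 < p) :
    ∀ k : ℕ, 0 < k →
      k * (c p - Real.log (16 * p)) + Real.log (16 * p) + 2 * Real.log k ≤ c (k * p) := by
  intro k
  induction k using Nat.strong_induction_on with
  | _ k ih =>
    intro hk
    rcases Nat.lt_or_ge k 2 with h2 | h2
    · obtain rfl : k = 1 := by omega
      simp
    · obtain ⟨i, j, hi, hj, hij, hlarge⟩ : ∃ i j : ℕ, 0 < i ∧ 0 < j ∧ i + j = k ∧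
          k ^ 3 ≤ 16 * (i * j) ^ 2 := by
        obtain ⟨m, rfl | rfl⟩ := Nat.even_or_odd' k
        · refine ⟨m, m, by omega, by omega, by omega, ?_⟩
          have hm : 1 ≤ m := by omega
          calc (2 * m) ^ 3 = 8 * m ^ 3 := by ring
            _ ≤ 16 * m ^ 4 := Nat.mul_le_mul (by norm_num) (Nat.pow_le_pow_right hm (by norm_num))
            _ = 16 * (m * m) ^ 2 := by ring
        · refine ⟨m, m + 1, by omega, by omega, by omega, ?_⟩
          obtain ⟨t, rfl⟩ : ∃ t, m = t + 1 := ⟨m - 1, by omega⟩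
          ring_nf
          nlinarith [sq_nonneg t, pow_nonneg (Nat.zero_le t) 3, pow_nonneg (Nat.zero_le t) 4]
      have hi' := ih i (by omega) hi
      have hj' := ih j (by omega) hj
      have h := hc (i * p) (j * p) (Nat.mul_pos hi hp) (Nat.mul_pos hj hp)
      rw [← add_mul, hij] at h
      have hpR : (0 : ℝ) < p := by exact_mod_cast hp
      have hkR : (0 : ℝ) < k := by exact_mod_cast hk
      have hiR : (0 : ℝ) < i := by exact_mod_cast hi
      have hjR : (0 : ℝ) < j := by exact_mod_cast hj
      have hsum : (k : ℝ) = i + j := by rw [← hij]; push_cast; ring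
      have hlog : 3 * Real.log k ≤ Real.log 16 + 2 * (Real.log i + Real.log j) := by
        have : (k : ℝ) ^ 3 ≤ 16 * (i * j) ^ 2 := by exact_mod_cast hlarge
        have := Real.log_le_log (by positivity) this
        rw [Real.log_mul (by norm_num) (by positivity), Real.log_pow, Real.log_pow,
          Real.log_mul hiR.ne' hjR.ne'] at this
        exact_mod_cast this
      have h16 : Real.log (16 * p) = Real.log 16 + Real.log p :=
        Real.log_mul (by norm_num) hpR.ne'
      rw [Nat.cast_mul, Real.log_mul hkR.ne' hpR.ne'] at h
      have hlin : (k : ℝ) * (c p - Real.log (16 * p)) =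
          i * (c p - Real.log (16 * p)) + j * (c p - Real.log (16 * p)) := by rw [hsum]; ring
      rw [hlin]
      linarith

theorem tendsto_log_div_nat : Tendsto (fun n : ℕ => Real.log n / n) atTop (𝓝 0) := by
  have := Real.isLittleO_log_id_atTop.tendsto_div_nhds_zero
  exact this.comp tendsto_natCast_atTop_atTop

theorem eventually_lt_div_of_almost_superadditive
    (hc : ∀ p q, 0 < p → 0 < q → c p + c q - Real.log ((p + q : ℕ) : ℝ) ≤ c (p + q))
    {p : ℕ} (hp : 0 < p) {a : ℝ} (ha : a < (c p - Real.log (16 * p)) / p) :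
    ∀ᶠ n : ℕ in atTop, a < c n / n := by
  set X := c p - Real.log (16 * p) with hX
  have hpR : (0 : ℝ) < p := by exact_mod_cast hp
  obtain ⟨M, hM⟩ : ∃ M : ℝ, ∀ r ∈ Finset.Icc 1 p, -c r ≤ M :=
    ⟨∑ r ∈ Finset.Icc 1 p, |c r|, fun r hr => (neg_le_abs _).trans
      (Finset.single_le_sum (f := fun r => |c r|) (fun _ _ => abs_nonneg _) hr)⟩
  have hbound : ∀ n : ℕ, p < n → X / p - (|X| + M) / n - Real.log n / n ≤ c n / n := by
    intro n hn
    have hnR : (0 : ℝ) < n := by exact_mod_cast hp.trans hn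
    have hdiv := Nat.div_add_mod (n - 1) p
    have hmod := Nat.mod_lt (n - 1) hp
    -- Dividing `n - 1` rather than `n` puts the remainder `r` in `1, …, p`; superadditivity is only
    -- assumed for positive arguments.
    set k := (n - 1) / p with hk
    set r := (n - 1) % p + 1 with hr
    have hkpos : 0 < k := Nat.div_pos (by omega) hp
    have hnk : k * p + r = n := by
      rw [Nat.mul_comm]
      omega
    have h1 := le_apply_mul_of_almost_superadditive hc hp k hkpos
    have h2 := hc (k * p) r (Nat.mul_pos hkpos hp) (by omega)
    rw [hnk] at h2
    have h3 := hM r (Finset.mem_Icc.2 ⟨by omega, by omega⟩)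
    have h4 : 0 ≤ Real.log k := Real.log_natCast_nonneg k
    have h5 : 0 ≤ Real.log (16 * p) := by
      have : (1 : ℝ) ≤ p := by exact_mod_cast hp
      exact Real.log_nonneg (by linarith)
    have h6 : (n : ℝ) / p * X - |X| ≤ k * X := by
      have hrp : (r : ℝ) ≤ p := by
        have : r ≤ p := by omega
        exact_mod_cast this
      have hnk' : (n : ℝ) = k * p + r := by rw [← hnk]; push_cast; ring
      have : (n : ℝ) / p = k + r / p := by rw [hnk']; field_simp
      rw [this, add_mul]
      have : (r : ℝ) / p * X ≤ 1 * |X| :=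
        (mul_le_mul_of_nonneg_left (le_abs_self X) (by positivity)).trans
          (mul_le_mul_of_nonneg_right ((div_le_one hpR).2 hrp) (abs_nonneg X))
      linarith
    rw [le_div_iff₀ hnR]
    have : (X / p - (|X| + M) / n - Real.log n / n) * n =
        (n : ℝ) / p * X - (|X| + M) - Real.log n := by field_simp
    rw [this]
    linarith
  have hlim : Tendsto (fun n : ℕ => X / p - (|X| + M) / n - Real.log n / n) atTop
      (𝓝 (X / p - 0 - 0)) :=
    (tendsto_const_nhds.sub (tendsto_const_div_atTop_nhds_zero_nat _)).sub tendsto_log_div_nat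
  rw [sub_zero, sub_zero] at hlim
  filter_upwards [hlim.eventually_const_lt ha, eventually_gt_atTop p] with n h1 h2
  exact h1.trans_le (hbound n h2)

/-- Fekete's lemma with a logarithmic error term. -/
theorem exists_tendsto_div_of_almost_superadditive
    (hc : ∀ p q, 0 < p → 0 < q → c p + c q - Real.log ((p + q : ℕ) : ℝ) ≤ c (p + q))
    {K : ℝ} (hK : ∀ n, 0 < n → c n / n ≤ K) :
    ∃ L, Tendsto (fun n : ℕ => c n / n) atTop (𝓝 L) := by
  refine tendsto_of_no_upcrossings (s := Set.univ) dense_univ ?_ ?_ ?_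
  · rintro a - b - hab ⟨hfa, hfb⟩
    have hlog : Tendsto (fun n : ℕ => Real.log (16 * n) / n) atTop (𝓝 0) := by
      have h : Tendsto (fun n : ℕ => Real.log 16 / n + Real.log n / n) atTop (𝓝 (0 + 0)) :=
        (tendsto_const_div_atTop_nhds_zero_nat _).add tendsto_log_div_nat
      rw [add_zero] at h
      refine h.congr' ?_
      filter_upwards [eventually_gt_atTop 0] with n hn
      have hn' : (n : ℝ) ≠ 0 := by exact_mod_cast hn.ne'
      rw [Real.log_mul (by norm_num) hn', add_div]
    -- Choose `p` with `c p / p > b` and with loss `log (16 * p) / p` below `b - a`. Then `c n / n`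
    -- eventually exceeds `a`, so it cannot drop below `a` infinitely often.
    obtain ⟨p, hbp, hpl, hp⟩ := (hfb.and_eventually
      ((hlog.eventually_lt_const (sub_pos.2 hab)).and (eventually_gt_atTop 0))).exists
    have hev := eventually_lt_div_of_almost_superadditive hc hp (a := a) (by
      rw [sub_div]
      linarith)
    obtain ⟨n, h1, h2⟩ := (hfa.and_eventually hev).exists
    exact lt_asymm h1 h2
  · exact isBoundedUnder_of_eventually_le (a := K)
      ((eventually_gt_atTop 0).mono fun n hn => hK n hn)
  · exact isBoundedUnder_of_eventually_ge
      ((eventually_lt_div_of_almost_superadditive hc one_pos (sub_one_lt _)).mono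
        fun n hn => hn.le)

end AlmostSuperadditive

/-! ### Normalization by factorials and the limits -/

theorem tendsto_log_factorial_div_sub_log :
    Tendsto (fun n : ℕ => Real.log n.factorial / n - Real.log n) atTop (𝓝 (-1)) := by
  have hs : Tendsto (fun n => Real.log (Stirling.stirlingSeq n)) atTop
      (𝓝 (Real.log √Real.pi)) :=
    Stirling.tendsto_stirlingSeq_sqrt_pi.log (by positivity)
  have h1 : Tendsto (fun n : ℕ => Real.log (Stirling.stirlingSeq n) / n) atTop (𝓝 0) :=
    hs.div_atTop tendsto_natCast_atTop_atTop
  have h2 : Tendsto (fun n : ℕ => Real.log (Stirling.stirlingSeq n) / n +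
      1 / 2 * (Real.log 2 / n + Real.log n / n) - 1) atTop (𝓝 (0 + 1 / 2 * (0 + 0) - 1)) :=
    (h1.add (((tendsto_const_div_atTop_nhds_zero_nat _).add tendsto_log_div_nat).const_mul
      _)).sub tendsto_const_nhds
  norm_num at h2
  refine h2.congr' ?_
  filter_upwards [eventually_gt_atTop 0] with n hn
  have hn' : (n : ℝ) ≠ 0 := by exact_mod_cast hn.ne'
  rw [Stirling.log_stirlingSeq_formula, Real.log_div hn' (Real.exp_pos 1).ne', Real.log_exp,
    Real.log_mul two_ne_zero hn']
  field_simp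
  ring

theorem rpow_div_eq_exp {x : ℝ} (hx : 0 < x) {n : ℕ} (hn : 0 < n) :
    x ^ (1 / (n : ℝ)) / n = Real.exp (Real.log x / n - Real.log n) := by
  have hn' : (0 : ℝ) < n := by exact_mod_cast hn
  rw [Real.exp_sub, Real.exp_log hn', Real.rpow_def_of_pos hx, mul_one_div]

/-- The logarithm of the normalized number of forests, indexed so as to be almost superadditive. -/
noncomputable def logForests (S : Set Pattern) (n : ℕ) : ℝ :=
  Real.log (numForests S (n - 1)) - Real.log (n - 1).factorial

/-- The index shift absorbs the new root: `(m + 1) + (n + 1) = (m + n + 1) + 1`. The error is the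
factor `m + n + 1` between `(m + n + 1)!` and `(m + n)!`, enlarged to `p + q`. -/
theorem logForests_almost_superadditive {S : Set Pattern} (hS : ∀ π ∈ S, ¬ π.BeginsWithSmallest)
    (p q : ℕ) (hp : 0 < p) (hq : 0 < q) :
    logForests S p + logForests S q - Real.log ((p + q : ℕ) : ℝ) ≤ logForests S (p + q) := by
  obtain ⟨m, rfl⟩ : ∃ m, p = m + 1 := ⟨p - 1, by omega⟩
  obtain ⟨n, rfl⟩ : ∃ n, q = n + 1 := ⟨q - 1, by omega⟩
  have hm : (0 : ℝ) < numForests S m := by exact_mod_cast numForests_pos hS m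
  have hn : (0 : ℝ) < numForests S n := by exact_mod_cast numForests_pos hS n
  have hmn : (0 : ℝ) < numForests S (m + n + 1) := by exact_mod_cast numForests_pos hS _
  have hfac : ∀ k : ℕ, (0 : ℝ) < k.factorial := fun k => by exact_mod_cast k.factorial_pos
  have h : ((m + n).factorial : ℝ) * (numForests S m * numForests S n) ≤
      m.factorial * n.factorial * numForests S (m + n + 1) := by
    have h1 := choose_mul_numForests_le hS m n
    rw [Nat.choose_symm_add] at h1
    have h2 := Nat.add_choose_mul_factorial_mul_factorial m n
    have h3 : (m + n).factorial * (numForests S m * numForests S n) ≤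
        m.factorial * n.factorial * numForests S (m + n + 1) := by
      rw [← h2]
      calc _ = m.factorial * n.factorial *
            ((m + n).choose n * (numForests S m * numForests S n)) := by ring
        _ ≤ _ := Nat.mul_le_mul_left _ h1
    exact_mod_cast h3
  have hlog := Real.log_le_log (by have := hfac (m + n); positivity) h
  rw [Real.log_mul (hfac _).ne' (by positivity), Real.log_mul hm.ne' hn.ne',
    Real.log_mul (by have := hfac m; have := hfac n; positivity) hmn.ne',
    Real.log_mul (hfac _).ne' (hfac _).ne'] at hlog
  have e1 : m + 1 + (n + 1) - 1 = m + n + 1 := by omega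
  have e2 : Real.log ((m + n + 1).factorial : ℝ) =
      Real.log ((m + n + 1 : ℕ) : ℝ) + Real.log ((m + n).factorial : ℝ) := by
    rw [Nat.factorial_succ, Nat.cast_mul, Real.log_mul (by positivity) (hfac _).ne']
  have e3 : Real.log ((m + n + 1 : ℕ) : ℝ) ≤ Real.log ((m + 1 + (n + 1) : ℕ) : ℝ) :=
    Real.log_le_log (by positivity) (by exact_mod_cast (by omega : m + n + 1 ≤ m + 1 + (n + 1)))
  simp only [logForests, e1, Nat.add_sub_cancel, e2]
  linarith

/-- Compare `f_m ≤ (m+1)^m` with Stirling's lower bound for `(m+1)!`: the terms in `log (m + 1)` of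
leading order cancel and at most `m + 1` is left. -/
theorem logForests_div_le {S : Set Pattern} (hS : ∀ π ∈ S, ¬ π.BeginsWithSmallest)
    (n : ℕ) (hn : 0 < n) : logForests S n / n ≤ 1 := by
  obtain ⟨m, rfl⟩ : ∃ m, n = m + 1 := ⟨n - 1, by omega⟩
  have hm : (0 : ℝ) < numForests S m := by exact_mod_cast numForests_pos hS m
  have h1 : Real.log (numForests S m) ≤ m * Real.log ((m + 1 : ℕ) : ℝ) := by
    rw [← Real.log_pow]
    exact Real.log_le_log hm (by exact_mod_cast numForests_le S m)
  have h2 := Stirling.le_log_factorial_stirling (n := m + 1) (by omega)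
  have h3 : 0 ≤ Real.log ((m + 1 : ℕ) : ℝ) := Real.log_natCast_nonneg _
  have h4 : 0 ≤ Real.log (2 * Real.pi) := Real.log_nonneg (by linarith [Real.pi_gt_three])
  have e2 : Real.log ((m + 1).factorial : ℝ) =
      Real.log ((m + 1 : ℕ) : ℝ) + Real.log (m.factorial : ℝ) := by
    rw [Nat.factorial_succ, Nat.cast_mul, Real.log_mul (by positivity) (by positivity)]
  rw [div_le_one (by positivity), logForests, Nat.add_sub_cancel]
  rw [e2] at h2
  have e3 : ((m + 1 : ℕ) : ℝ) * Real.log ((m + 1 : ℕ) : ℝ) =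
    m * Real.log ((m + 1 : ℕ) : ℝ) + Real.log ((m + 1 : ℕ) : ℝ) := by push_cast; ring
  rw [e3] at h2
  linarith

theorem exists_tendsto_of_not_beginsWithSmallest
    {S : Set Pattern} (hS : ∀ π ∈ S, ¬ π.BeginsWithSmallest) : ∃ L : ℝ,
    Tendsto (fun n : ℕ => (numForests S n : ℝ) ^ (1 / (n : ℝ)) / (n : ℝ)) atTop (𝓝 L) ∧
    Tendsto (fun n : ℕ => (numTrees S n : ℝ) ^ (1 / (n : ℝ)) / (n : ℝ)) atTop (𝓝 L) := by
  obtain ⟨L, hL⟩ := exists_tendsto_div_of_almost_superadditive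
    (logForests_almost_superadditive hS) (logForests_div_le hS)
  have hpos : ∀ n, (0 : ℝ) < numForests S n := fun n => by exact_mod_cast numForests_pos hS n
  have hforest : Tendsto (fun n : ℕ => Real.log (numForests S n) / n - Real.log n) atTop
      (𝓝 (L - 1)) := by
    -- The factor `(n + 1) / n` replaces the denominator `n + 1` of the shifted sequence by `n`.
    have hratio : Tendsto (fun n : ℕ => 1 + 1 / (n : ℝ)) atTop (𝓝 (1 + 0)) :=
      tendsto_const_nhds.add tendsto_one_div_atTop_nhds_zero_nat
    have h := ((hL.comp (tendsto_add_atTop_nat 1)).mul hratio).add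
      tendsto_log_factorial_div_sub_log
    rw [add_zero, mul_one, ← sub_eq_add_neg] at h
    refine h.congr' ?_
    filter_upwards [eventually_gt_atTop 0] with n hn
    have hn' : (n : ℝ) ≠ 0 := by exact_mod_cast hn.ne'
    have hn1 : ((n : ℝ) + 1) ≠ 0 := by positivity
    simp only [Function.comp, logForests, Nat.add_sub_cancel]
    push_cast
    field_simp
    ring
  have hlower : Tendsto (fun n : ℕ => Real.log (numForests S (n - 1)) / n - Real.log n) atTop
      (𝓝 (L - 1)) := by
    -- Here `n!` replaces `(n-1)!`, which costs only the vanishing term `log n / n`.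
    have h := (hL.add tendsto_log_factorial_div_sub_log).sub tendsto_log_div_nat
    rw [sub_zero, ← sub_eq_add_neg] at h
    refine h.congr' ?_
    filter_upwards [eventually_gt_atTop 0] with n hn
    obtain ⟨m, rfl⟩ : ∃ m, n = m + 1 := ⟨n - 1, by omega⟩
    have e2 : Real.log ((m + 1).factorial : ℝ) =
        Real.log ((m + 1 : ℕ) : ℝ) + Real.log (m.factorial : ℝ) := by
      rw [Nat.factorial_succ, Nat.cast_mul, Real.log_mul (by positivity) (by positivity)]
    rw [e2, logForests, Nat.add_sub_cancel]
    ring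
  refine ⟨Real.exp (L - 1), ?_, ?_⟩
  · refine ((Real.continuous_exp.tendsto _).comp hforest).congr' ?_
    filter_upwards [eventually_gt_atTop 0] with n hn
    exact (rpow_div_eq_exp (hpos n) hn).symm
  · refine tendsto_of_tendsto_of_tendsto_of_le_of_le'
      ((Real.continuous_exp.tendsto _).comp hlower)
      ((Real.continuous_exp.tendsto _).comp hforest) ?_ ?_
    · filter_upwards [eventually_gt_atTop 0] with n hn
      simp only [Function.comp]
      rw [← rpow_div_eq_exp (hpos _) hn]
      obtain ⟨m, rfl⟩ : ∃ m, n = m + 1 := ⟨n - 1, by omega⟩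
      have : (numForests S m : ℝ) ≤ numTrees S (m + 1) := by
        exact_mod_cast numForests_le_numTrees_succ hS m
      rw [Nat.add_sub_cancel]
      gcongr
    · filter_upwards [eventually_gt_atTop 0] with n hn
      simp only [Function.comp]
      rw [← rpow_div_eq_exp (hpos _) hn]
      have : (numTrees S n : ℝ) ≤ numForests S n := by
        exact_mod_cast numTrees_le_numForests S n
      gcongr

theorem theorem1p8 (S : Set Pattern)
    (hS : (∀ π ∈ S, ¬ π.BeginsWithSmallest) ∨ (∀ π ∈ S, ¬ π.BeginsWithLargest)) :
    ∃ L : ℝ,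
      Tendsto (fun n : ℕ => (numForests S n : ℝ) ^ (1 / (n : ℝ)) / (n : ℝ)) atTop (𝓝 L) ∧
      Tendsto (fun n : ℕ => (numTrees S n : ℝ) ^ (1 / (n : ℝ)) / (n : ℝ)) atTop (𝓝 L) := by
  rcases hS with hS | hS
  · exact exists_tendsto_of_not_beginsWithSmallest hS
  · have hS' : ∀ π ∈ {π : Pattern | π.compl ∈ S}, ¬ π.BeginsWithSmallest := by
      intro π hπ h
      refine hS _ hπ ?_
      change Fin.rev (π.2 0) = Fin.last π.1
      rw [show π.2 0 = 0 from h, Fin.rev_zero]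
    have h := exists_tendsto_of_not_beginsWithSmallest hS'
    simpa only [numForests_compl, numTrees_compl] using h
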